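/- Let $M$ be a closed surface with a (simplicial) triangulation $\mathcal T=(V,E,F)$, $V=\{v_1,\dots,v_N\}$, and let $\Phi:E\to[0,\pi)$ be a weight, $\Phi_{ij}=\Phi(e_{ij})$, such that, with $I_{ij}=\cos\Phi_{ij}$, every triangle $\triangle_{ijk}\in F$ satisfies $$\langle\star\rangle\qquad I_{ij}+I_{ik}I_{jk}\ge 0,\quad I_{ik}+I_{ij}I_{jk}\ge 0,\quad I_{jk}+I_{ij}I_{ik}\ge 0 .$$ For a circle packing metric $r=(r_1,\dots,r_N)\in\mathbb R_{>0}^N$, let $$l_{ij}=\cosh^{-1}\big(\cosh r_i\cosh r_j+\sinh r_i\sinh r_j\cos\Phi_{ij}\big)$$ be the length of the edge $e_{ij}$; let $\theta_i^{jk}$ be the angle at $v_i$ of the hyperbolic triangle $\triangle_{ijk}\in F$ with side lengths $l_{ij},l_{ik},l_{jk}$, and $\operatorname{Area}(\triangle_{ijk})=\pi-\theta_i^{jk}-\theta_j^{ik}-\theta_k^{ij}$ its area. Put $u_i=\ln\tanh(r_i/2)$, so that $\partial/\partial u_i=\sinh r_i\,\partial/\partial r_i$, and set $$A_i=\frac{\partial}{\partial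 u_i}\Big(\sum_{\triangle_{ijk}\in F}\operatorname{Area}(\triangle_{ijk})\Big),\qquad B_{ij}=\frac{\partial\theta_i^{jk}}{\partial u_j}+\frac{\partial\theta_i^{jl}}{\partial u_j},$$ where the sum runs over the triangles at the vertex $v_i$, and $\triangle_{ijk},\triangle_{ijl}$ are the two triangles containing the edge $e_{ij}\in E$. (For every $r\in\mathbb R_{>0}^N$ the lengths $l_{ij},l_{ik},l_{jk}$ of a triangle in $F$ satisfy the strict triangle inequalities, and its angles are differentiable functions of $r$; this is part of the assertion.) Then there are constants $C_1(\Phi),C_2(\Phi)>0$, depending only on the weighted triangulation and not on $r$, such that for every circle packing metric $r\in\mathbb R_{>0}^N$ $$0<A_i\le C_1\quad\text{for every vertex } v_i\in V,\qquad 0\le B_{ij}\le C_2\quad\text{for every edge } e_{ij}\in E,$$ and $B_{ij}>0$ except in the degenerate case $\Phi_{ij}=0$, $\Phi_{ik}+\Phi_{jk}=\pi$ and $\Phi_{il}+\Phi_{jl}=\pi$, in which $B_{ij}=0$. -/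

import Mathlib

noncomputable section

/-- For a set `F` of triangles on the vertices `v_1, …, v_N`, the link of the vertex `i`: its
vertices are the neighbours of `i`, and its edges are the sides opposite to `i` of the triangles
at `i`. -/
def vertexLink {N : ℕ} (F : Finset (Finset (Fin N))) (i : Fin N) :
    SimpleGraph {j : Fin N // j ≠ i ∧ ∃ f ∈ F, i ∈ f ∧ j ∈ f} where
  Adj j k := j ≠ k ∧ ({i, j.1, k.1} : Finset (Fin N)) ∈ F
  symm := ⟨fun j k h => ⟨h.1.symm, by
    have h2 := h.2
    rwa [Finset.pair_comm] at h2⟩⟩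
  loopless := ⟨fun _ h => h.1 rfl⟩

/-- A triangulation of a closed surface with vertex set `V = {v_1, …, v_N}`: a finite simplicial
complex, given by its set `F` of triangles, all of whose vertices and edges are faces of triangles,
such that each edge lies in exactly two triangles and the link of each vertex is a cycle.
As each edge lies in exactly two triangles, the link of a vertex is a finite simple graph all of
whose vertices have degree two, so that it is a cycle if and only if it is connected (and,
in particular, nonempty). -/
structure ClosedTriangulation (N : ℕ) where
  /-- The set `F` of triangles. -/
  faces : Finset (Finset (Fin N))
  card_face : ∀ f ∈ faces, f.card = 3
  two_faces : ∀ i j : Fin N, i ≠ j → (∃ f ∈ faces, i ∈ f ∧ j ∈ f) →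
    (faces.filter (fun f => i ∈ f ∧ j ∈ f)).card = 2
  link_connected : ∀ i : Fin N, (vertexLink faces i).Connected

namespace ClosedTriangulation

variable {N : ℕ} (T : ClosedTriangulation N)

/-- `v_i ∼ v_j`, that is, `{v_i, v_j}` is an edge. -/
def Adj (i j : Fin N) : Prop := i ≠ j ∧ ∃ f ∈ T.faces, i ∈ f ∧ j ∈ f

/-- `△_{ijk} ∈ F`. -/
def IsFace (i j k : Fin N) : Prop := ({i, j, k} : Finset (Fin N)) ∈ T.faces

instance (i j k : Fin N) : Decidable (T.IsFace i j k) :=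
  inferInstanceAs (Decidable (({i, j, k} : Finset (Fin N)) ∈ T.faces))

/-- `Φ` restricts to a weight `E → [0, π)`. Only the values of `Φ` on the edges matter. -/
def IsWeight (Φ : Sym2 (Fin N) → ℝ) : Prop :=
  ∀ i j, T.Adj i j → Φ s(i, j) ∈ Set.Ico 0 Real.pi

/-- The condition `⟨⋆⟩`: `I_{ij} + I_{ik} I_{jk} ≥ 0` for all triangles `△_{ijk}`, where
`I = cos Φ`. The labels run over all orderings of a triangle, so these are all three
inequalities. -/
def Star (Φ : Sym2 (Fin N) → ℝ) : Prop :=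
  ∀ i j k, T.IsFace i j k →
    0 ≤ Real.cos (Φ s(i, j)) + Real.cos (Φ s(i, k)) * Real.cos (Φ s(j, k))

end ClosedTriangulation

section Geometry

variable {N : ℕ} (Φ : Sym2 (Fin N) → ℝ)

/-- The hyperbolic length `l_{ij}` of an edge in the circle packing metric `r`. -/
def edgeLength (r : Fin N → ℝ) (i j : Fin N) : ℝ :=
  Real.arcosh (Real.cosh (r i) * Real.cosh (r j)
    + Real.sinh (r i) * Real.sinh (r j) * Real.cos (Φ s(i, j)))

/-- The angle `θ_i^{jk}` at `v_i` of the hyperbolic triangle with side lengths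
`l_{ij}, l_{ik}, l_{jk}` (hyperbolic law of cosines). -/
def triAngle (r : Fin N → ℝ) (i j k : Fin N) : ℝ :=
  Real.arccos
    ((Real.cosh (edgeLength Φ r i j) * Real.cosh (edgeLength Φ r i k)
        - Real.cosh (edgeLength Φ r j k))
      / (Real.sinh (edgeLength Φ r i j) * Real.sinh (edgeLength Φ r i k)))

/-- The area of the hyperbolic triangle `△_{ijk}`. -/
def triArea (r : Fin N → ℝ) (i j k : Fin N) : ℝ :=
  Real.pi - triAngle Φ r i j k - triAngle Φ r j i k - triAngle Φ r k i j

/-- `∂g/∂u_j = sinh r_j · ∂g/∂r_j`, the partial derivative of a function `g` of the metric `r` in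
the coordinates `u_j = log (tanh (r_j / 2))`, for which `du_j / dr_j = 1 / sinh r_j`. -/
def uDeriv (g : (Fin N → ℝ) → ℝ) (j : Fin N) (r : Fin N → ℝ) : ℝ :=
  Real.sinh (r j) * deriv (fun t => g (Function.update r j t)) (r j)

/-- `B_{ij} = ∂θ_i^{jk}/∂u_j + ∂θ_i^{jl}/∂u_j`, where `△_{ijk}`, `△_{ijl}` are the two triangles
that contain the edge `{v_i, v_j}`. -/
def coeffB (T : ClosedTriangulation N) (r : Fin N → ℝ) (i j : Fin N) : ℝ :=
  ∑ k with T.IsFace i j k, uDeriv (fun ρ => triAngle Φ ρ i j k) j r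

/-- `A_i = ∂/∂u_i` of the total area of the triangles `△_{ijk} ∈ F` at the vertex `v_i`. Each of
them is listed once, through the pair `j < k` of its two other vertices. -/
def coeffA (T : ClosedTriangulation N) (r : Fin N → ℝ) (i : Fin N) : ℝ :=
  uDeriv (fun ρ => ∑ p : Fin N × Fin N with p.1 < p.2 ∧ T.IsFace i p.1 p.2,
    triArea Φ ρ i p.1 p.2) i r

end Geometry

end

open Real

/-- The Gram determinant of three points of the hyperbolic plane, in terms of the hyperbolic
cosines of their distances. -/
noncomputable def gramDet (a b c : ℝ) : ℝ := 1 + 2 * a * b * c - a ^ 2 - b ^ 2 - c ^ 2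

/-- The hyperbolic cosine of the length of an edge between circles of radii `x` and `y`, where `g`
is the cosine of the weight. -/
noncomputable def coshLen (g x y : ℝ) : ℝ := cosh x * cosh y + sinh x * sinh y * g

/-- The angle of a hyperbolic triangle between sides of hyperbolic cosines `a`, `b`, opposite to
the side of hyperbolic cosine `c`. -/
noncomputable def hypAngle (a b c : ℝ) : ℝ := arccos ((a * b - c) / (√(a ^ 2 - 1) * √(b ^ 2 - 1)))

/-- The Gram determinant of a triangle of circles, divided by the squares of the hyperbolic sines
of the radii, in terms of the hyperbolic cotangents `x`, `y`, `z` of the radii. -/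
noncomputable def cothGram (α β γ x y z : ℝ) : ℝ :=
  x ^ 2 * (1 - α ^ 2) + y ^ 2 * (1 - β ^ 2) + z ^ 2 * (1 - γ ^ 2)
    + 2 * x * y * (γ + α * β) + 2 * x * z * (β + α * γ) + 2 * y * z * (α + β * γ)
    + (α ^ 2 + β ^ 2 + γ ^ 2 + 2 * α * β * γ - 1)

/-- Half of the derivative of `cothGram` in its last variable. -/
noncomputable def cothGrad (α β γ x y z : ℝ) : ℝ :=
  z * (1 - γ ^ 2) + x * (β + α * γ) + y * (α + β * γ)

/-- The derivative of the angle at the first vertex of a triangle of circles of radii `x`, `y`, `z`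
in the `u`-coordinate of the second one. -/
noncomputable def angleSlope (α β γ x y z : ℝ) : ℝ :=
  cothGrad α β γ (cosh x / sinh x) (cosh y / sinh y) (cosh z / sinh z)
    / √(cothGram α β γ (cosh x / sinh x) (cosh y / sinh y) (cosh z / sinh z))
    * (sinh x * sinh y / (coshLen γ x y ^ 2 - 1))

/-- The cosines of the weights of a triangle that satisfies the condition `⟨⋆⟩`. -/
structure StarCos (α β γ : ℝ) : Prop where
  ha : -1 < α
  hb : -1 < β
  hc : -1 < γ
  ha' : α ≤ 1
  hb' : β ≤ 1
  hc' : γ ≤ 1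
  sa : 0 ≤ α + β * γ
  sb : 0 ≤ β + α * γ
  sc : 0 ≤ γ + α * β

lemma StarCos.swap {α β γ : ℝ} (h : StarCos α β γ) : StarCos α γ β where
  ha := h.ha
  hb := h.hc
  hc := h.hb
  ha' := h.ha'
  hb' := h.hc'
  hc' := h.hb'
  sa := by linarith [h.sa, mul_comm β γ]
  sb := h.sc
  sc := h.sb

lemma cothGram_swap_left (α β γ x y z : ℝ) : cothGram β α γ y x z = cothGram α β γ x y z := by
  unfold cothGram; ring

lemma coshLen_comm (g x y : ℝ) : coshLen g x y = coshLen g y x := by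
  unfold coshLen; ring

lemma angleSlope_swap (α β γ x y z : ℝ) : angleSlope β α γ y x z = angleSlope α β γ x y z := by
  unfold angleSlope
  rw [cothGram_swap_left, coshLen_comm γ y x, mul_comm (sinh y)]
  congr 2
  unfold cothGrad; ring

lemma gramDet_comm (a b c : ℝ) : gramDet a b c = gramDet b a c := by unfold gramDet; ring

lemma gramDet_rotate (a b c : ℝ) : gramDet a b c = gramDet a c b := by unfold gramDet; ring

lemma deriv_cos_law_aux {A B G a b c a' b' c' : ℝ} (hA : 0 < A) (hB : 0 < B) (hG : 0 < G)
    (qa : A ^ 2 = a ^ 2 - 1) (qb : B ^ 2 = b ^ 2 - 1) :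
    -(1 / (G / (A * B))) * (((a' * b + a * b' - c') * (A * B)
      - (a * b - c) * (2 * a * a' / (2 * A) * B + A * (2 * b * b' / (2 * B)))) / (A * B) ^ 2)
      = (c' - (a * c - b) / (a ^ 2 - 1) * a' - (b * c - a) / (b ^ 2 - 1) * b') / G := by
  rw [← qa, ← qb]
  have h1 : b - (a * b - c) * a / A ^ 2 = (a * c - b) / A ^ 2 := by
    field_simp
    linear_combination b * qa
  have h2 : a - (a * b - c) * b / B ^ 2 = (b * c - a) / B ^ 2 := by
    field_simp
    linear_combination a * qb
  rw [← h1, ← h2]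
  field_simp
  ring

lemma one_sub_cosLaw_sq {a b c : ℝ} (pa : 0 < a ^ 2 - 1) (pb : 0 < b ^ 2 - 1) :
    1 - ((a * b - c) / (√(a ^ 2 - 1) * √(b ^ 2 - 1))) ^ 2
      = gramDet a b c / ((a ^ 2 - 1) * (b ^ 2 - 1)) := by
  rw [div_pow, mul_pow, sq_sqrt pa.le, sq_sqrt pb.le]
  unfold gramDet
  field_simp
  ring

lemma cosLaw_ne {a b c : ℝ} (h1 : 1 < a) (h2 : 1 < b) (hD : 0 < gramDet a b c) :
    (a * b - c) / (√(a ^ 2 - 1) * √(b ^ 2 - 1)) ≠ -1 ∧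
      (a * b - c) / (√(a ^ 2 - 1) * √(b ^ 2 - 1)) ≠ 1 := by
  have pa : 0 < a ^ 2 - 1 := by nlinarith
  have pb : 0 < b ^ 2 - 1 := by nlinarith
  have hsq := one_sub_cosLaw_sq (c := c) pa pb
  have hpos := div_pos hD (mul_pos pa pb)
  constructor <;> intro h <;> rw [h] at hsq <;> norm_num at hsq <;> linarith

lemma differentiableAt_hypAngle {E : Type*} [NormedAddCommGroup E] [NormedSpace ℝ E]
    {a b c : E → ℝ} {t : E} (ha : DifferentiableAt ℝ a t) (hb : DifferentiableAt ℝ b t)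
    (hc : DifferentiableAt ℝ c t) (h1 : 1 < a t) (h2 : 1 < b t)
    (hD : 0 < gramDet (a t) (b t) (c t)) :
    DifferentiableAt ℝ (fun s => hypAngle (a s) (b s) (c s)) t := by
  have pa : 0 < a t ^ 2 - 1 := by nlinarith
  have pb : 0 < b t ^ 2 - 1 := by nlinarith
  have da := ((ha.fun_pow 2).sub_const 1).sqrt pa.ne'
  have db := ((hb.fun_pow 2).sub_const 1).sqrt pb.ne'
  have dq := ((ha.fun_mul hb).fun_sub hc).fun_mul ((da.fun_mul db).fun_inv
    (mul_pos (sqrt_pos.2 pa) (sqrt_pos.2 pb)).ne')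
  simp_rw [← div_eq_mul_inv] at dq
  exact (differentiableAt_arccos.2 (cosLaw_ne h1 h2 hD)).comp t dq

lemma hasDerivAt_hypAngle {a b c : ℝ → ℝ} {a' b' c' t : ℝ} (ha : HasDerivAt a a' t)
    (hb : HasDerivAt b b' t) (hc : HasDerivAt c c' t) (h1 : 1 < a t) (h2 : 1 < b t)
    (hD : 0 < gramDet (a t) (b t) (c t)) :
    HasDerivAt (fun s => hypAngle (a s) (b s) (c s))
      ((c' - (a t * c t - b t) / (a t ^ 2 - 1) * a' - (b t * c t - a t) / (b t ^ 2 - 1) * b')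
        / √(gramDet (a t) (b t) (c t))) t := by
  have pa : 0 < a t ^ 2 - 1 := by nlinarith
  have pb : 0 < b t ^ 2 - 1 := by nlinarith
  have sa := sqrt_pos.2 pa
  have sb := sqrt_pos.2 pb
  have da := ((ha.fun_pow 2).sub_const 1).sqrt pa.ne'
  have db := ((hb.fun_pow 2).sub_const 1).sqrt pb.ne'
  have dq := ((ha.fun_mul hb).fun_sub hc).fun_div (da.fun_mul db) (mul_pos sa sb).ne'
  obtain ⟨n1, n2⟩ := cosLaw_ne h1 h2 hD
  refine ((hasDerivAt_arccos n1 n2).comp t dq).congr_deriv ?_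
  rw [one_sub_cosLaw_sq pa pb, sqrt_div hD.le, sqrt_mul pa.le,
    ← deriv_cos_law_aux sa sb (sqrt_pos.2 hD) (sq_sqrt pa.le) (sq_sqrt pb.le)]
  norm_num

lemma coshLen_sq_sub_one (g x y : ℝ) : coshLen g x y ^ 2 - 1
    = (cosh x * sinh y + sinh x * cosh y * g) ^ 2 + sinh x ^ 2 * (1 - g ^ 2) := by
  unfold coshLen
  linear_combination (cosh x ^ 2 - g ^ 2 * sinh x ^ 2) * cosh_sq y + cosh_sq x

lemma hasDerivAt_coshLen (g x y : ℝ) :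
    HasDerivAt (fun t => coshLen g x t) (cosh x * sinh y + sinh x * cosh y * g) y := by
  unfold coshLen
  exact ((hasDerivAt_cosh y).const_mul _).add (((hasDerivAt_sinh y).const_mul _).mul_const _)

lemma one_le_coshLen {g : ℝ} (h : -1 ≤ g) (h' : g ≤ 1) (x y : ℝ) : 1 ≤ coshLen g x y := by
  have h1 := one_le_cosh (x - y)
  have h2 := one_le_cosh (x + y)
  rw [cosh_sub] at h1
  rw [cosh_add] at h2
  unfold coshLen
  nlinarith

lemma one_lt_coshLen {g x y : ℝ} (h : -1 < g) (hx : 0 < x) (hy : 0 < y) : 1 < coshLen g x y := by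
  have h1 := one_le_cosh (x - y)
  rw [cosh_sub] at h1
  have := mul_pos (mul_pos (sinh_pos_iff.2 hx) (sinh_pos_iff.2 hy)) (by linarith : 0 < g + 1)
  unfold coshLen
  linarith

lemma gramDet_coshLen (α β γ : ℝ) {x y z : ℝ} (hx : 0 < x) (hy : 0 < y) (hz : 0 < z) :
    gramDet (coshLen γ x y) (coshLen β x z) (coshLen α y z)
      = (sinh x * sinh y * sinh z) ^ 2
        * cothGram α β γ (cosh x / sinh x) (cosh y / sinh y) (cosh z / sinh z) := by
  have px := sinh_pos_iff.2 hx
  have py := sinh_pos_iff.2 hy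
  have pz := sinh_pos_iff.2 hz
  have key : (cosh x ^ 2 - sinh x ^ 2) * (cosh y ^ 2 - sinh y ^ 2) * (cosh z ^ 2 - sinh z ^ 2)
      + 2 * coshLen γ x y * coshLen β x z * coshLen α y z
      - (cosh z ^ 2 - sinh z ^ 2) * coshLen γ x y ^ 2
      - (cosh y ^ 2 - sinh y ^ 2) * coshLen β x z ^ 2
      - (cosh x ^ 2 - sinh x ^ 2) * coshLen α y z ^ 2
      = (sinh x * sinh y * sinh z) ^ 2
        * cothGram α β γ (cosh x / sinh x) (cosh y / sinh y) (cosh z / sinh z) := by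
    unfold coshLen cothGram
    field_simp
    ring
  simp only [cosh_sq_sub_sinh_sq] at key
  rw [← key, gramDet]
  ring

lemma one_lt_coth {x : ℝ} (hx : 0 < x) : 1 < cosh x / sinh x :=
  (one_lt_div (sinh_pos_iff.2 hx)).2 (sinh_lt_cosh x)

namespace StarCos

variable {α β γ : ℝ}

lemma coef_nonneg (h : StarCos α β γ) : 0 ≤ 1 - α ^ 2 ∧ 0 ≤ 1 - β ^ 2 ∧ 0 ≤ 1 - γ ^ 2 := by
  obtain ⟨ha, hb, hc, ha', hb', hc', -, -, -⟩ := h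
  refine ⟨?_, ?_, ?_⟩ <;> nlinarith

/-- The homogeneous part of `cothGram` bounds it from below, up to a constant. -/
lemma exists_homogeneous_le (h : StarCos α β γ) : ∃ ε > 0, ∀ x y z : ℝ, 1 ≤ x → 1 ≤ y → 1 ≤ z →
    ε * (x ^ 2 * (1 - α ^ 2) + y ^ 2 * (1 - β ^ 2) + z ^ 2 * (1 - γ ^ 2)
      + 2 * x * y * (γ + α * β) + 2 * x * z * (β + α * γ) + 2 * y * z * (α + β * γ))
      ≤ cothGram α β γ x y z := by
  obtain ⟨na, nb, nc⟩ := h.coef_nonneg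
  have hm : 0 < 2 * ((1 + α) * (1 + β) * (1 + γ)) := by
    have := h.ha; have := h.hb; have := h.hc
    have : 0 < 1 + α := by linarith
    have : 0 < 1 + β := by linarith
    have : 0 < 1 + γ := by linarith
    positivity
  have hK : 0 ≤ (1 - α ^ 2) + (1 - β ^ 2) + (1 - γ ^ 2)
      + 2 * (γ + α * β) + 2 * (β + α * γ) + 2 * (α + β * γ) := by
    linarith [h.sa, h.sb, h.sc]
  obtain ⟨m, hm'⟩ : ∃ m, m = 2 * ((1 + α) * (1 + β) * (1 + γ)) := ⟨_, rfl⟩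
  obtain ⟨K, hK'⟩ : ∃ K, K = (1 - α ^ 2) + (1 - β ^ 2) + (1 - γ ^ 2)
      + 2 * (γ + α * β) + 2 * (β + α * γ) + 2 * (α + β * γ) := ⟨_, rfl⟩
  rw [← hm'] at hm
  rw [← hK'] at hK
  refine ⟨m / (m + K), by positivity, fun x y z hx hy hz => ?_⟩
  obtain ⟨q, hq⟩ : ∃ q, q = x ^ 2 * (1 - α ^ 2) + y ^ 2 * (1 - β ^ 2) + z ^ 2 * (1 - γ ^ 2)
      + 2 * x * y * (γ + α * β) + 2 * x * z * (β + α * γ) + 2 * y * z * (α + β * γ) := ⟨_, rfl⟩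
  rw [← hq]
  have hqK : K ≤ q := by
    have e1 : 0 ≤ (x ^ 2 - 1) * (1 - α ^ 2) := mul_nonneg (by nlinarith) na
    have e2 : 0 ≤ (y ^ 2 - 1) * (1 - β ^ 2) := mul_nonneg (by nlinarith) nb
    have e3 : 0 ≤ (z ^ 2 - 1) * (1 - γ ^ 2) := mul_nonneg (by nlinarith) nc
    have e4 : 0 ≤ (x * y - 1) * (γ + α * β) := mul_nonneg (by nlinarith) h.sc
    have e5 : 0 ≤ (x * z - 1) * (β + α * γ) := mul_nonneg (by nlinarith) h.sb
    have e6 : 0 ≤ (y * z - 1) * (α + β * γ) := mul_nonneg (by nlinarith) h.sa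
    rw [hK', hq]
    linarith
  have hQ : cothGram α β γ x y z = q - K + m := by
    rw [hq, hK', hm', cothGram]; ring
  rw [hQ, div_mul_eq_mul_div, div_le_iff₀ (by positivity)]
  nlinarith [mul_nonneg hK (sub_nonneg.2 hqK), mul_pos hm hm]

lemma exists_sqrt_cothGram_ge (h : StarCos α β γ) : ∃ κ > 0, ∀ x y z w : ℝ, 1 ≤ x → 1 ≤ y → 1 ≤ z →
    0 ≤ w → w ≤ x → w ≤ y → κ * w ≤ √(cothGram α β γ x y z) ∧
      κ * (z * (1 - γ ^ 2)) ≤ √(cothGram α β γ x y z) := by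
  obtain ⟨na, nb, nc⟩ := h.coef_nonneg
  obtain ⟨ε, hε, H⟩ := h.exists_homogeneous_le
  have hη : 0 < (1 - α ^ 2) + (1 - β ^ 2) + 2 * (γ + α * β) := by
    have := h.sc
    rcases na.lt_or_eq with h1 | h1
    · linarith
    rcases nb.lt_or_eq with h2 | h2
    · linarith
    have e1 : α = 1 := by nlinarith [h.ha, h.ha']
    have e2 : β = 1 := by nlinarith [h.hb, h.hb']
    rw [e1, e2]
    linarith [h.hc]
  set η := (1 - α ^ 2) + (1 - β ^ 2) + 2 * (γ + α * β) with hη'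
  refine ⟨min (√(ε * η)) (√ε), by positivity, fun x y z w hx hy hz hw hwx hwy => ?_⟩
  have hH := H x y z hx hy hz
  have e1 : 0 ≤ x ^ 2 * (1 - α ^ 2) := by positivity
  have e2 : 0 ≤ y ^ 2 * (1 - β ^ 2) := by positivity
  have e3 : 0 ≤ z ^ 2 * (1 - γ ^ 2) := by positivity
  have e4 : 0 ≤ 2 * x * y * (γ + α * β) := mul_nonneg (by positivity) h.sc
  have e5 : 0 ≤ 2 * x * z * (β + α * γ) := mul_nonneg (by positivity) h.sb
  have e6 : 0 ≤ 2 * y * z * (α + β * γ) := mul_nonneg (by positivity) h.sa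
  constructor
  · refine (mul_le_mul_of_nonneg_right (min_le_left _ _) hw).trans (le_sqrt_of_sq_le ?_)
    rw [mul_pow, sq_sqrt (by positivity)]
    refine le_trans ?_ hH
    rw [mul_assoc]
    refine mul_le_mul_of_nonneg_left ?_ hε.le
    have f1 : 0 ≤ (x ^ 2 - w ^ 2) * (1 - α ^ 2) := mul_nonneg (by nlinarith) na
    have f2 : 0 ≤ (y ^ 2 - w ^ 2) * (1 - β ^ 2) := mul_nonneg (by nlinarith) nb
    have f3 : 0 ≤ (x * y - w ^ 2) * (γ + α * β) := mul_nonneg (by nlinarith) h.sc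
    rw [hη']
    linarith
  · refine (mul_le_mul_of_nonneg_right (min_le_right _ _) (by positivity)).trans
      (le_sqrt_of_sq_le ?_)
    rw [mul_pow, sq_sqrt hε.le]
    refine le_trans (mul_le_mul_of_nonneg_left ?_ hε.le) hH
    have : z ^ 2 * (1 - γ ^ 2) * (1 - γ ^ 2) ≤ z ^ 2 * (1 - γ ^ 2) * 1 :=
      mul_le_mul_of_nonneg_left (by nlinarith [sq_nonneg γ]) e3
    nlinarith

lemma cothGram_pos (h : StarCos α β γ) {x y z : ℝ} (hx : 1 ≤ x) (hy : 1 ≤ y) (hz : 1 ≤ z) :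
    0 < cothGram α β γ x y z := by
  obtain ⟨κ, hκ, H⟩ := h.exists_sqrt_cothGram_ge
  have := (H x y z 1 hx hy hz zero_le_one hx hy).1
  exact sqrt_pos.1 (lt_of_lt_of_le (by linarith) this)

lemma gramDet_pos (h : StarCos α β γ) {x y z : ℝ} (hx : 0 < x) (hy : 0 < y) (hz : 0 < z) :
    0 < gramDet (coshLen γ x y) (coshLen β x z) (coshLen α y z) := by
  rw [gramDet_coshLen α β γ hx hy hz]
  have px := sinh_pos_iff.2 hx
  have py := sinh_pos_iff.2 hy
  have pz := sinh_pos_iff.2 hz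
  have := h.cothGram_pos (one_lt_coth hx).le (one_lt_coth hy).le (one_lt_coth hz).le
  positivity

/-- The two bounds on the gradient of `√cothGram`. -/
lemma exists_cothGrad_le (h : StarCos α β γ) : ∃ C > 0, ∀ x y z : ℝ, 1 ≤ x → 1 ≤ y → 1 ≤ z →
    cothGrad α β γ x y z * (x * y) ≤ C * (x ^ 2 + y ^ 2) * √(cothGram α β γ x y z) ∧
    cothGrad α β γ x y z ≤ C * (x * y) * √(cothGram α β γ x y z) := by
  obtain ⟨na, nb, nc⟩ := h.coef_nonneg
  obtain ⟨κ, hκ, H⟩ := h.exists_sqrt_cothGram_ge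
  have p1 : β + α * γ ≤ 2 := by nlinarith [h.ha, h.hb, h.hc, h.ha', h.hb', h.hc']
  have p2 : α + β * γ ≤ 2 := by nlinarith [h.ha, h.hb, h.hc, h.ha', h.hb', h.hc']
  refine ⟨5 / κ, by positivity, fun x y z hx hy hz => ?_⟩
  have hxy : 1 ≤ x * y := by nlinarith
  have hL : cothGrad α β γ x y z ≤ z * (1 - γ ^ 2) + 2 * (x + y) := by
    have := mul_le_mul_of_nonneg_left p1 (by linarith : 0 ≤ x)
    have := mul_le_mul_of_nonneg_left p2 (by linarith : 0 ≤ y)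
    unfold cothGrad
    linarith
  obtain ⟨h1, hz'⟩ := H x y z 1 hx hy hz zero_le_one hx hy
  set s := √(cothGram α β γ x y z)
  have hs : 0 ≤ s := sqrt_nonneg _
  constructor
  · have hmain : κ * (x * y * (x + y)) ≤ 2 * (x ^ 2 + y ^ 2) * s := by
      rcases le_total x y with hle | hle
      · have := (H x y z x hx hy hz (by linarith) le_rfl hle).1
        have e := mul_le_mul_of_nonneg_right this (by positivity : 0 ≤ y * (x + y))
        have : s * (y * (x + y)) ≤ s * (2 * (x ^ 2 + y ^ 2)) :=
          mul_le_mul_of_nonneg_left (by nlinarith) hs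
        linarith
      · have := (H x y z y hx hy hz (by linarith) hle le_rfl).1
        have e := mul_le_mul_of_nonneg_right this (by positivity : 0 ≤ x * (x + y))
        have : s * (x * (x + y)) ≤ s * (2 * (x ^ 2 + y ^ 2)) :=
          mul_le_mul_of_nonneg_left (by nlinarith) hs
        linarith
    have e1 := mul_le_mul_of_nonneg_right hL (by positivity : 0 ≤ κ * (x * y))
    have e2 := mul_le_mul_of_nonneg_right hz' (by positivity : 0 ≤ x * y)
    have e3 : s * (x * y) ≤ s * (x ^ 2 + y ^ 2) :=
      mul_le_mul_of_nonneg_left (by nlinarith [sq_nonneg (x - y)]) hs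
    rw [div_mul_eq_mul_div, div_mul_eq_mul_div, le_div_iff₀ hκ]
    linarith
  · have e1 := mul_le_mul_of_nonneg_left hL hκ.le
    have e2 : x + y ≤ 2 * (x * y) := by nlinarith
    have e3 := mul_le_mul_of_nonneg_left e2 hκ.le
    have e4 := mul_le_mul_of_nonneg_right h1 (by positivity : 0 ≤ x * y)
    have e5 : s * 1 ≤ s * (x * y) := mul_le_mul_of_nonneg_left hxy hs
    rw [div_mul_eq_mul_div, div_mul_eq_mul_div, le_div_iff₀ hκ]
    linarith

end StarCos

lemma coshLen_sq_sub_one_eq_coth (γ : ℝ) {x y : ℝ} (hx : 0 < x) (hy : 0 < y) :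
    coshLen γ x y ^ 2 - 1 = (sinh x * sinh y) ^ 2
      * ((cosh x / sinh x) ^ 2 + (cosh y / sinh y) ^ 2
        + 2 * γ * (cosh x / sinh x) * (cosh y / sinh y) - (1 - γ ^ 2)) := by
  have px := sinh_pos_iff.2 hx
  have py := sinh_pos_iff.2 hy
  rw [coshLen_sq_sub_one]
  field_simp
  linear_combination (-sinh x ^ 2) * cosh_sq y + (sinh x ^ 2 * γ ^ 2) * cosh_sq y

lemma quadratic_coth_ge {γ s t : ℝ} (h : -1 < γ) (h' : γ ≤ 1) (hs : 1 ≤ s) (ht : 1 ≤ t) :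
    (1 + γ) ^ 2 / 8 * (s ^ 2 + t ^ 2) ≤ s ^ 2 + t ^ 2 + 2 * γ * s * t - (1 - γ ^ 2) := by
  have h2 : 2 * (s * t) ≤ s ^ 2 + t ^ 2 := by nlinarith [sq_nonneg (s - t)]
  have h3 : 2 ≤ s ^ 2 + t ^ 2 := by nlinarith
  obtain ⟨σ, hσ⟩ : ∃ σ, σ = s ^ 2 + t ^ 2 := ⟨_, rfl⟩
  rw [← hσ] at h2 h3 ⊢
  rcases le_total γ 0 with h0 | h0
  · have e1 : γ * σ ≤ γ * (2 * (s * t)) := mul_le_mul_of_nonpos_left h2 h0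
    have e2 := mul_nonneg (mul_nonneg (by linarith : 0 ≤ 1 + γ) (by linarith : 0 ≤ 1 - γ))
      (sub_nonneg.2 h3)
    have e3 := mul_nonneg (sq_nonneg (1 + γ)) (by linarith : 0 ≤ σ)
    linarith
  · have e1 : 0 ≤ γ * (s * t) := mul_nonneg h0 (by nlinarith)
    have e2 : 0 ≤ (4 - (1 + γ) ^ 2) * σ := mul_nonneg (by nlinarith) (by linarith)
    nlinarith [sq_nonneg γ]

namespace StarCos

variable {α β γ : ℝ}

lemma cothGrad_nonneg (h : StarCos α β γ) {x y z : ℝ} (hx : 0 ≤ x) (hy : 0 ≤ y) (hz : 0 ≤ z) :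
    0 ≤ cothGrad α β γ x y z :=
  add_nonneg (add_nonneg (mul_nonneg hz h.coef_nonneg.2.2) (mul_nonneg hx h.sb))
    (mul_nonneg hy h.sa)

lemma cothGrad_eq_zero_iff (h : StarCos α β γ) {x y z : ℝ} (hx : 0 < x) (hy : 0 < y)
    (hz : 0 < z) : cothGrad α β γ x y z = 0 ↔ γ = 1 ∧ α + β = 0 := by
  constructor
  · intro h0
    have e1 := mul_nonneg hz.le h.coef_nonneg.2.2
    have e2 := mul_nonneg hx.le h.sb
    have e3 := mul_nonneg hy.le h.sa
    unfold cothGrad at h0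
    have f1 : z * (1 - γ ^ 2) = 0 := by linarith
    have f3 : y * (α + β * γ) = 0 := by linarith
    have g1 := (mul_eq_zero.1 f1).resolve_left hz.ne'
    have g3 := (mul_eq_zero.1 f3).resolve_left hy.ne'
    have hγ : γ = 1 := by nlinarith [h.hc, h.hc']
    rw [hγ, mul_one] at g3
    exact ⟨hγ, g3⟩
  · rintro ⟨rfl, h0⟩
    unfold cothGrad
    linear_combination (x + y) * h0

lemma coshLen_sq_sub_one_pos (h : StarCos α β γ) {x y : ℝ} (hx : 0 < x) (hy : 0 < y) :
    0 < coshLen γ x y ^ 2 - 1 := by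
  nlinarith [one_lt_coshLen h.hc hx hy]

lemma angleSlope_nonneg (h : StarCos α β γ) {x y z : ℝ} (hx : 0 < x) (hy : 0 < y) (hz : 0 < z) :
    0 ≤ angleSlope α β γ x y z := by
  have px := sinh_pos_iff.2 hx
  have py := sinh_pos_iff.2 hy
  have hW := h.coshLen_sq_sub_one_pos hx hy
  have hL := h.cothGrad_nonneg (zero_le_one.trans (one_lt_coth hx).le)
    (zero_le_one.trans (one_lt_coth hy).le) (zero_le_one.trans (one_lt_coth hz).le)
  unfold angleSlope
  positivity

lemma angleSlope_eq_zero_iff (h : StarCos α β γ) {x y z : ℝ} (hx : 0 < x) (hy : 0 < y)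
    (hz : 0 < z) : angleSlope α β γ x y z = 0 ↔ γ = 1 ∧ α + β = 0 := by
  have hQ := sqrt_pos.2 (h.cothGram_pos (one_lt_coth hx).le (one_lt_coth hy).le (one_lt_coth hz).le)
  have hp := div_pos (mul_pos (sinh_pos_iff.2 hx) (sinh_pos_iff.2 hy))
    (h.coshLen_sq_sub_one_pos hx hy)
  rw [← h.cothGrad_eq_zero_iff (zero_lt_one.trans (one_lt_coth hx))
    (zero_lt_one.trans (one_lt_coth hy)) (zero_lt_one.trans (one_lt_coth hz)), angleSlope,
    mul_eq_zero, div_eq_zero_iff]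
  simp only [hp.ne', hQ.ne', or_false]

lemma exists_angleSlope_le (h : StarCos α β γ) : ∃ C : ℝ, ∀ x y z : ℝ, 0 < x → 0 < y → 0 < z →
    angleSlope α β γ x y z ≤ C ∧ (coshLen γ x y - 1) * angleSlope α β γ x y z ≤ C := by
  obtain ⟨K, hK, H⟩ := h.exists_cothGrad_le
  have hγ : 0 < 1 + γ := by linarith [h.hc]
  refine ⟨max (K * (8 / (1 + γ) ^ 2)) (K * (2 / (1 + γ))), fun x y z hx hy hz => ?_⟩
  have px := sinh_pos_iff.2 hx
  have py := sinh_pos_iff.2 hy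
  have tx := (one_lt_coth hx).le
  have ty := (one_lt_coth hy).le
  have tz := (one_lt_coth hz).le
  have hW := h.coshLen_sq_sub_one_pos hx hy
  have ha := one_lt_coshLen h.hc hx hy
  have hL := h.cothGrad_nonneg (zero_le_one.trans tx) (zero_le_one.trans ty) (zero_le_one.trans tz)
  have hs := sqrt_pos.2 (h.cothGram_pos tx ty tz)
  have hq := quadratic_coth_ge h.hc h.hc' tx ty
  obtain ⟨H1, H2⟩ := H _ _ _ tx ty tz
  have hWeq := coshLen_sq_sub_one_eq_coth γ hx hy
  have hc : 1 ≤ sinh x * sinh y * (cosh x / sinh x * (cosh y / sinh y)) := by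
    have : sinh x * sinh y * (cosh x / sinh x * (cosh y / sinh y)) = cosh x * cosh y := by
      field_simp
    rw [this]
    nlinarith [one_le_cosh x, one_le_cosh y]
  have haeq : coshLen γ x y = sinh x * sinh y * (cosh x / sinh x * (cosh y / sinh y) + γ) := by
    unfold coshLen
    field_simp
  unfold angleSlope
  generalize cosh x / sinh x = s at *
  generalize cosh y / sinh y = t at *
  generalize cosh z / sinh z = u at *
  generalize √(cothGram α β γ s t u) = Q at *
  generalize cothGrad α β γ s t u = L at *
  obtain ⟨p, hp⟩ : ∃ p, p = sinh x * sinh y := ⟨_, rfl⟩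
  have hp0 : 0 < p := hp ▸ mul_pos px py
  rw [← hp] at hc hWeq haeq ⊢
  constructor
  · refine le_trans ?_ (le_max_left _ _)
    rw [div_mul_div_comm, div_le_iff₀ (by positivity), hWeq]
    have e1 : L * 1 ≤ L * (p * (s * t)) := mul_le_mul_of_nonneg_left hc hL
    have e2 := mul_le_mul_of_nonneg_left H1 hp0.le
    have e3 := mul_le_mul_of_nonneg_left hq (by positivity : 0 ≤ p * K * Q * (8 / (1 + γ) ^ 2))
    have e4 : p * K * Q * (8 / (1 + γ) ^ 2) * ((1 + γ) ^ 2 / 8 * (s ^ 2 + t ^ 2))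
        = p * K * Q * (s ^ 2 + t ^ 2) := by field_simp
    have e5 : L ≤ p * K * Q * (8 / (1 + γ) ^ 2)
        * (s ^ 2 + t ^ 2 + 2 * γ * s * t - (1 - γ ^ 2)) := by linarith
    have e6 := mul_le_mul_of_nonneg_right e5 hp0.le
    linarith
  · refine le_trans ?_ (le_max_right _ _)
    have hfac : (coshLen γ x y - 1) * (L / Q * (p / (coshLen γ x y ^ 2 - 1)))
        = L * p / (Q * (coshLen γ x y + 1)) := by
      have h1 : coshLen γ x y ^ 2 - 1 = (coshLen γ x y - 1) * (coshLen γ x y + 1) := by ring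
      have h2 : coshLen γ x y - 1 ≠ 0 := by linarith
      have h3 : coshLen γ x y + 1 ≠ 0 := by linarith
      rw [h1]
      field_simp
    rw [hfac, div_le_iff₀ (mul_pos hs (by linarith))]
    have hst : 1 ≤ s * t := by nlinarith
    have e0 : (1 + γ) / 2 * (s * t) ≤ s * t + γ := by
      nlinarith [mul_nonneg (by linarith [h.hc'] : 0 ≤ 1 - γ) (sub_nonneg.2 hst)]
    have e1 := mul_le_mul_of_nonneg_right H2 hp0.le
    have e2 := mul_le_mul_of_nonneg_left e0 (by positivity : 0 ≤ K * Q * p * (2 / (1 + γ)))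
    have e3 : K * Q * p * (2 / (1 + γ)) * ((1 + γ) / 2 * (s * t)) = K * Q * p * (s * t) := by
      field_simp
    have e4 : 0 ≤ K * (2 / (1 + γ)) * Q := by positivity
    rw [haeq]
    linarith

end StarCos

lemma cos_law_angleSlope (α β γ : ℝ) {x y z : ℝ} (h : StarCos α β γ) (hx : 0 < x) (hy : 0 < y)
    (hz : 0 < z) :
    ((cosh z * sinh y + sinh z * cosh y * α) - (coshLen γ x y * coshLen α y z - coshLen β x z)
      / (coshLen γ x y ^ 2 - 1) * (cosh x * sinh y + sinh x * cosh y * γ))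
      / √(gramDet (coshLen γ x y) (coshLen β x z) (coshLen α y z))
      = angleSlope α β γ x y z / sinh y := by
  have px := sinh_pos_iff.2 hx
  have py := sinh_pos_iff.2 hy
  have pz := sinh_pos_iff.2 hz
  have hW := h.coshLen_sq_sub_one_pos hx hy
  have hs := sqrt_pos.2 (h.cothGram_pos (one_lt_coth hx).le (one_lt_coth hy).le (one_lt_coth hz).le)
  rw [gramDet_coshLen α β γ hx hy hz, sqrt_mul (sq_nonneg _), sqrt_sq (by positivity)]
  have h1 := coshLen_sq_sub_one γ x y
  have h2 : (cosh x * sinh y + sinh x * cosh y * γ) * (cosh z * sinh y + sinh z * cosh y * α)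
      - coshLen γ x y * coshLen α y z + coshLen β x z = sinh x * sinh z * (β + α * γ) := by
    unfold coshLen
    linear_combination (-cosh x * cosh z + sinh x * sinh z * α * γ) * cosh_sq y
  have h3 : (coshLen γ x y ^ 2 - 1) * (cosh z * sinh y + sinh z * cosh y * α)
      - (coshLen γ x y * coshLen α y z - coshLen β x z)
        * (cosh x * sinh y + sinh x * cosh y * γ)
      = sinh x * (sinh x * sinh y * sinh z
        * cothGrad α β γ (cosh x / sinh x) (cosh y / sinh y) (cosh z / sinh z)) := by
    have h4 : sinh x * sinh y * sinh z
        * cothGrad α β γ (cosh x / sinh x) (cosh y / sinh y) (cosh z / sinh z)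
        = cosh z * sinh x * sinh y * (1 - γ ^ 2) + cosh x * sinh y * sinh z * (β + α * γ)
          + cosh y * sinh x * sinh z * (α + β * γ) := by
      unfold cothGrad
      field_simp
    rw [h4]
    linear_combination (cosh z * sinh y + sinh z * cosh y * α) * h1
      + (cosh x * sinh y + sinh x * cosh y * γ) * h2
  have h5 : (cosh z * sinh y + sinh z * cosh y * α)
      - (coshLen γ x y * coshLen α y z - coshLen β x z) / (coshLen γ x y ^ 2 - 1)
        * (cosh x * sinh y + sinh x * cosh y * γ)
      = sinh x * (sinh x * sinh y * sinh z
        * cothGrad α β γ (cosh x / sinh x) (cosh y / sinh y) (cosh z / sinh z))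
        / (coshLen γ x y ^ 2 - 1) := by
    rw [← h3, eq_div_iff hW.ne', sub_mul, div_mul_eq_mul_div, div_mul_cancel₀ _ hW.ne']
    ring
  rw [h5, angleSlope]
  generalize cothGrad α β γ _ _ _ = L
  generalize √(cothGram α β γ _ _ _) = Q at *
  generalize coshLen γ x y ^ 2 - 1 = W at *
  field_simp

lemma hasDerivAt_coshLen_left (g x y : ℝ) :
    HasDerivAt (fun t => coshLen g t y) (cosh y * sinh x + sinh y * cosh x * g) x := by
  simp_rw [fun t => coshLen_comm g t y]
  exact hasDerivAt_coshLen g y x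

/-- The derivative of an angle in the radius of another vertex. -/
lemma StarCos.hasDerivAt_angle {α β γ x y z : ℝ} (h : StarCos α β γ) (hx : 0 < x) (hy : 0 < y)
    (hz : 0 < z) :
    HasDerivAt (fun t => hypAngle (coshLen γ x t) (coshLen β x z) (coshLen α t z))
      (angleSlope α β γ x y z / sinh y) y := by
  refine (hasDerivAt_hypAngle (hasDerivAt_coshLen γ x y) (hasDerivAt_const y (coshLen β x z))
    (hasDerivAt_coshLen_left α y z) (one_lt_coshLen h.hc hx hy) (one_lt_coshLen h.hb hx hz)
    (h.gramDet_pos hx hy hz)).congr_deriv ?_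
  rw [mul_zero, sub_zero, cos_law_angleSlope α β γ h hx hy hz]

lemma StarCos.rotate {α β γ : ℝ} (h : StarCos α β γ) : StarCos β α γ where
  ha := h.hb
  hb := h.ha
  hc := h.hc
  ha' := h.hb'
  hb' := h.ha'
  hc' := h.hc'
  sa := h.sb
  sb := h.sa
  sc := by linarith [h.sc, mul_comm α β]

lemma diag_deriv_eq {a b c a' b' G : ℝ} (ha : a ^ 2 - 1 ≠ 0) (hb : b ^ 2 - 1 ≠ 0) (hG : G ≠ 0) :
    (0 - (a * c - b) / (a ^ 2 - 1) * a' - (b * c - a) / (b ^ 2 - 1) * b') / G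
      = -(a * ((b' - (a * b - c) / (a ^ 2 - 1) * a') / G)
        + b * ((a' - (b * a - c) / (b ^ 2 - 1) * b') / G)) := by
  field_simp
  ring

/-- The derivative of the area of a triangle in the radius of its first vertex. -/
lemma StarCos.hasDerivAt_area {α β γ x y z : ℝ} (h : StarCos α β γ) (hx : 0 < x) (hy : 0 < y)
    (hz : 0 < z) :
    HasDerivAt (fun t => π - hypAngle (coshLen γ t y) (coshLen β t z) (coshLen α y z)
        - hypAngle (coshLen γ y t) (coshLen α y z) (coshLen β t z)
        - hypAngle (coshLen β z t) (coshLen α z y) (coshLen γ t y))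
      (((coshLen γ x y - 1) * angleSlope α β γ x y z
        + (coshLen β x z - 1) * angleSlope α γ β x z y) / sinh x) x := by
  have d1 := hasDerivAt_hypAngle (hasDerivAt_coshLen_left γ x y) (hasDerivAt_coshLen_left β x z)
    (hasDerivAt_const x (coshLen α y z)) (one_lt_coshLen h.hc hx hy) (one_lt_coshLen h.hb hx hz)
    (h.gramDet_pos hx hy hz)
  have d2 := h.rotate.hasDerivAt_angle hy hx hz
  have d3 := h.swap.rotate.hasDerivAt_angle hz hx hy
  refine (((hasDerivAt_const x π).fun_sub d1).fun_sub d2 |>.fun_sub d3).congr_deriv ?_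
  have e2 := cos_law_angleSlope β α γ h.rotate hy hx hz
  have e3 := cos_law_angleSlope γ α β h.swap.rotate hz hx hy
  rw [angleSlope_swap, gramDet_rotate, coshLen_comm γ y x] at e2
  rw [angleSlope_swap, gramDet_rotate, gramDet_comm, coshLen_comm β z x, coshLen_comm α z y] at e3
  have hG := sqrt_pos.2 (h.gramDet_pos hx hy hz)
  rw [diag_deriv_eq (h.coshLen_sq_sub_one_pos hx hy).ne'
    (h.swap.coshLen_sq_sub_one_pos hx hz).ne' hG.ne', e2, e3, angleSlope_swap α β,
    angleSlope_swap α γ]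
  ring

section Geometry

variable {N : ℕ} (Φ : Sym2 (Fin N) → ℝ)

lemma edgeLength_nonneg (r : Fin N → ℝ) (i j : Fin N) : 0 ≤ edgeLength Φ r i j :=
  arcosh_nonneg (one_le_coshLen (neg_one_le_cos _) (cos_le_one _) _ _)

lemma cosh_edgeLength (r : Fin N → ℝ) (i j : Fin N) :
    cosh (edgeLength Φ r i j) = coshLen (cos (Φ s(i, j))) (r i) (r j) :=
  cosh_arcosh (one_le_coshLen (neg_one_le_cos _) (cos_le_one _) _ _)

lemma sinh_edgeLength (r : Fin N → ℝ) (i j : Fin N) :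
    sinh (edgeLength Φ r i j) = √(coshLen (cos (Φ s(i, j))) (r i) (r j) ^ 2 - 1) :=
  sinh_arcosh (one_le_coshLen (neg_one_le_cos _) (cos_le_one _) _ _)

lemma triAngle_eq (r : Fin N → ℝ) (i j k : Fin N) :
    triAngle Φ r i j k = hypAngle (coshLen (cos (Φ s(i, j))) (r i) (r j))
      (coshLen (cos (Φ s(i, k))) (r i) (r k)) (coshLen (cos (Φ s(j, k))) (r j) (r k)) := by
  simp only [triAngle, hypAngle, cosh_edgeLength, sinh_edgeLength]

end Geometry

lemma lt_add_of_gramDet_pos {u v w : ℝ} (hv : 0 ≤ v) (hw : 0 ≤ w)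
    (h : 0 < gramDet (cosh u) (cosh v) (cosh w)) : u < v + w := by
  refine lt_of_abs_lt ((cosh_lt_cosh.1 ?_).trans_eq (abs_of_nonneg (add_nonneg hv hw)))
  rw [cosh_add]
  have h1 : (cosh u - cosh v * cosh w) ^ 2 < (sinh v * sinh w) ^ 2 := by
    unfold gramDet at h
    have := cosh_sq v
    have := cosh_sq w
    have e : (sinh v * sinh w) ^ 2 = (cosh v ^ 2 - 1) * (cosh w ^ 2 - 1) := by
      rw [mul_pow, sinh_sq, sinh_sq]
    nlinarith
  have := abs_lt_of_sq_lt_sq h1 (mul_nonneg (sinh_nonneg_iff.2 hv) (sinh_nonneg_iff.2 hw))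
  linarith [(abs_lt.1 this).2]

namespace ClosedTriangulation

variable {N : ℕ} {T : ClosedTriangulation N} {i j k : Fin N}

lemma IsFace.ne (h : T.IsFace i j k) : i ≠ j ∧ i ≠ k ∧ j ≠ k := by
  have h3 := T.card_face _ h
  refine ⟨?_, ?_, ?_⟩ <;> rintro rfl
  · have := Finset.card_le_two (a := i) (b := k)
    simp at h3
    omega
  · have := Finset.card_le_two (a := j) (b := i)
    rw [Finset.insert_comm] at h3
    simp at h3
    omega
  · have := Finset.card_le_two (a := i) (b := j)
    simp at h3
    omega

lemma IsFace.swap (h : T.IsFace i j k) : T.IsFace i k j := by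
  unfold IsFace at *
  rwa [Finset.pair_comm]

lemma IsFace.swap_left (h : T.IsFace i j k) : T.IsFace j i k := by
  unfold IsFace at *
  rwa [Finset.insert_comm]

lemma IsFace.adj (h : T.IsFace i j k) : T.Adj i j :=
  ⟨h.ne.1, _, h, by simp, by simp⟩

lemma exists_isFace (h : T.Adj i j) : ∃ k, T.IsFace i j k := by
  obtain ⟨hij, f, hf, hi, hj⟩ := h
  obtain ⟨a, b, c, hab, hac, hbc, rfl⟩ := Finset.card_eq_three.1 (T.card_face f hf)
  have key : ∀ k, ({i, j, k} : Finset (Fin N)) = {a, b, c} → ∃ k, T.IsFace i j k := fun k hk =>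
    ⟨k, by rwa [IsFace, hk]⟩
  simp only [Finset.mem_insert, Finset.mem_singleton] at hi hj
  rcases hi with rfl | rfl | rfl <;> rcases hj with rfl | rfl | rfl <;>
    first
    | exact absurd rfl hij
    | exact key a (by ext x; simp only [Finset.mem_insert, Finset.mem_singleton]; tauto)
    | exact key b (by ext x; simp only [Finset.mem_insert, Finset.mem_singleton]; tauto)
    | exact key c (by ext x; simp only [Finset.mem_insert, Finset.mem_singleton] <;> tauto)

lemma exists_isFace_lt (T : ClosedTriangulation N) (i : Fin N) :
    ∃ p : Fin N × Fin N, p.1 < p.2 ∧ T.IsFace i p.1 p.2 := by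
  obtain ⟨⟨j, hji, f, hf, hif, hjf⟩⟩ := (T.link_connected i).nonempty
  obtain ⟨k, hk⟩ := exists_isFace (T := T) ⟨hji.symm, f, hf, hif, hjf⟩
  rcases lt_or_gt_of_ne hk.ne.2.2 with h | h
  · exact ⟨(j, k), h, hk⟩
  · exact ⟨(k, j), h, hk.swap⟩

variable {Φ : Sym2 (Fin N) → ℝ}

lemma Star.starCos (hΦ : T.IsWeight Φ) (hstar : T.Star Φ) (h : T.IsFace i j k) :
    StarCos (cos (Φ s(j, k))) (cos (Φ s(i, k))) (cos (Φ s(i, j))) := by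
  have key : ∀ {a b : Fin N}, T.Adj a b → -1 < cos (Φ s(a, b)) := fun {a b} hab => by
    obtain ⟨h0, h1⟩ := hΦ a b hab
    rw [← cos_pi]
    exact cos_lt_cos_of_nonneg_of_le_pi h0 le_rfl h1
  refine ⟨key h.swap_left.swap.adj, key h.swap.adj, key h.adj, cos_le_one _, cos_le_one _,
    cos_le_one _, ?_, ?_, ?_⟩
  · have := hstar _ _ _ h.swap_left.swap
    rw [Sym2.eq_swap (a := j) (b := i), Sym2.eq_swap (a := k) (b := i)] at this
    linarith
  · have := hstar _ _ _ h.swap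
    rw [Sym2.eq_swap (a := k) (b := j)] at this
    linarith
  · have := hstar _ _ _ h
    linarith

/-- The equality case of the monotonicity of angles, in terms of weights. -/
lemma IsWeight.cos_eq_one_and_iff (hΦ : T.IsWeight Φ) (h : T.IsFace i j k) :
    (cos (Φ s(i, j)) = 1 ∧ cos (Φ s(j, k)) + cos (Φ s(i, k)) = 0) ↔
      Φ s(i, j) = 0 ∧ Φ s(i, k) + Φ s(j, k) = π := by
  obtain ⟨a0, a1⟩ := hΦ _ _ h.adj
  obtain ⟨b0, b1⟩ := hΦ _ _ h.swap.adj
  obtain ⟨c0, c1⟩ := hΦ _ _ h.swap_left.swap.adj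
  refine and_congr ?_ ?_
  · rw [cos_eq_one_iff_of_lt_of_lt (by linarith) (by linarith)]
  · rw [← eq_neg_iff_add_eq_zero, ← cos_pi_sub,
      injOn_cos.eq_iff ⟨c0, c1.le⟩ ⟨by linarith, by linarith⟩]
    constructor <;> intro h <;> linarith

section Derivatives

variable {r : Fin N → ℝ}

lemma uDeriv_eq_of_hasDerivAt {g : (Fin N → ℝ) → ℝ} {D : ℝ} (hr : 0 < r i)
    (h : HasDerivAt (fun t => g (Function.update r i t)) (D / sinh (r i)) (r i)) :
    uDeriv g i r = D := by
  have := sinh_pos_iff.2 hr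
  rw [uDeriv, h.deriv]
  field_simp

lemma edgeLength_lt (hΦ : T.IsWeight Φ) (hstar : T.Star Φ) (h : T.IsFace i j k)
    (hr : ∀ i, 0 < r i) : edgeLength Φ r i j < edgeLength Φ r i k + edgeLength Φ r k j := by
  refine lt_add_of_gramDet_pos (edgeLength_nonneg _ _ _ _) (edgeLength_nonneg _ _ _ _) ?_
  simp only [cosh_edgeLength]
  rw [Sym2.eq_swap (a := k) (b := j), coshLen_comm _ (r k)]
  exact (hstar.starCos hΦ h).gramDet_pos (hr i) (hr j) (hr k)

lemma differentiableAt_triAngle (hΦ : T.IsWeight Φ) (hstar : T.Star Φ) (h : T.IsFace i j k)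
    (hr : ∀ i, 0 < r i) : DifferentiableAt ℝ (fun ρ => triAngle Φ ρ i j k) r := by
  have H := hstar.starCos hΦ h
  simp_rw [triAngle_eq]
  have hd : ∀ (g : ℝ) (a b : Fin N),
      DifferentiableAt ℝ (fun ρ : Fin N → ℝ => coshLen g (ρ a) (ρ b)) r := fun g a b => by
    unfold coshLen
    fun_prop
  exact differentiableAt_hypAngle (hd _ _ _) (hd _ _ _) (hd _ _ _)
    (one_lt_coshLen H.hc (hr i) (hr j)) (one_lt_coshLen H.hb (hr i) (hr k))
    (H.gramDet_pos (hr i) (hr j) (hr k))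

lemma uDeriv_triAngle (hΦ : T.IsWeight Φ) (hstar : T.Star Φ) (h : T.IsFace i j k)
    (hr : ∀ i, 0 < r i) : uDeriv (fun ρ => triAngle Φ ρ i j k) j r
      = angleSlope (cos (Φ s(j, k))) (cos (Φ s(i, k))) (cos (Φ s(i, j))) (r i) (r j) (r k) := by
  obtain ⟨hij, hik, hjk⟩ := h.ne
  refine uDeriv_eq_of_hasDerivAt (hr j) ?_
  simp only [triAngle_eq, Function.update_self, Function.update_of_ne hij,
    Function.update_of_ne hjk.symm]
  exact (hstar.starCos hΦ h).hasDerivAt_angle (hr i) (hr j) (hr k)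

lemma hasDerivAt_triArea (hΦ : T.IsWeight Φ) (hstar : T.Star Φ) (h : T.IsFace i j k)
    (hr : ∀ i, 0 < r i) : HasDerivAt (fun t => triArea Φ (Function.update r i t) i j k)
      (((coshLen (cos (Φ s(i, j))) (r i) (r j) - 1)
          * angleSlope (cos (Φ s(j, k))) (cos (Φ s(i, k))) (cos (Φ s(i, j))) (r i) (r j) (r k)
        + (coshLen (cos (Φ s(i, k))) (r i) (r k) - 1)
          * angleSlope (cos (Φ s(j, k))) (cos (Φ s(i, j))) (cos (Φ s(i, k))) (r i) (r k) (r j))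
        / sinh (r i)) (r i) := by
  obtain ⟨hij, hik, hjk⟩ := h.ne
  simp only [triArea, triAngle_eq, Function.update_self, Function.update_of_ne hij.symm,
    Function.update_of_ne hik.symm]
  rw [Sym2.eq_swap (a := j) (b := i), Sym2.eq_swap (a := k) (b := i),
    Sym2.eq_swap (a := k) (b := j)]
  exact (hstar.starCos hΦ h).hasDerivAt_area (hr i) (hr j) (hr k)

end Derivatives

end ClosedTriangulation

open ClosedTriangulation

theorem theorem1p2 {N : ℕ} (T : ClosedTriangulation N) (Φ : Sym2 (Fin N) → ℝ)
    (hΦ : T.IsWeight Φ) (hstar : T.Star Φ) :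
    ∃ C₁ C₂ : ℝ, 0 < C₁ ∧ 0 < C₂ ∧ ∀ r : Fin N → ℝ, (∀ i, 0 < r i) →
      -- the faces are hyperbolic triangles, whose angles are differentiable in the metric
      (∀ i j k, T.IsFace i j k →
        edgeLength Φ r i j < edgeLength Φ r i k + edgeLength Φ r k j ∧
        DifferentiableAt ℝ (fun ρ => triAngle Φ ρ i j k) r) ∧
      (∀ i, 0 < coeffA Φ T r i ∧ coeffA Φ T r i ≤ C₁) ∧
      (∀ i j, T.Adj i j →
        0 ≤ coeffB Φ T r i j ∧ coeffB Φ T r i j ≤ C₂ ∧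
        (coeffB Φ T r i j = 0 ↔
          Φ s(i, j) = 0 ∧ ∀ k, T.IsFace i j k → Φ s(i, k) + Φ s(j, k) = Real.pi)) := by
  let slope (r : Fin N → ℝ) (i j k : Fin N) : ℝ :=
    angleSlope (cos (Φ s(j, k))) (cos (Φ s(i, k))) (cos (Φ s(i, j))) (r i) (r j) (r k)
  let len (r : Fin N → ℝ) (i j : Fin N) : ℝ := coshLen (cos (Φ s(i, j))) (r i) (r j)
  have hC : ∀ i j k, ∃ C : ℝ, T.IsFace i j k → ∀ r : Fin N → ℝ, (∀ i, 0 < r i) →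
      slope r i j k ≤ C ∧ (len r i j - 1) * slope r i j k ≤ C := fun i j k => by
    by_cases h : T.IsFace i j k
    · obtain ⟨C, hC⟩ := (hstar.starCos hΦ h).exists_angleSlope_le
      exact ⟨C, fun _ r hr => hC _ _ _ (hr i) (hr j) (hr k)⟩
    · exact ⟨0, fun h' => absurd h' h⟩
  choose C hC using hC
  have hswap : ∀ (r : Fin N → ℝ) (i j k : Fin N),
      angleSlope (cos (Φ s(j, k))) (cos (Φ s(i, j))) (cos (Φ s(i, k))) (r i) (r k) (r j)
        = slope r i k j := fun r i j k => by
    simp only [slope]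
    rw [Sym2.eq_swap (a := k) (b := j)]
  refine ⟨1 + ∑ i, ∑ p : Fin N × Fin N, (|C i p.1 p.2| + |C i p.2 p.1|),
    1 + ∑ i, ∑ j, ∑ k, |C i j k|, by positivity, by positivity, fun r hr =>
    ⟨fun i j k h => ⟨edgeLength_lt hΦ hstar h hr, differentiableAt_triAngle hΦ hstar h hr⟩,
      fun i => ?_, fun i j hij => ?_⟩⟩
  · have hA : coeffA Φ T r i = ∑ p : Fin N × Fin N with p.1 < p.2 ∧ T.IsFace i p.1 p.2,
        ((len r i p.1 - 1) * slope r i p.1 p.2 + (len r i p.2 - 1) * slope r i p.2 p.1) := by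
      refine uDeriv_eq_of_hasDerivAt (hr i) ?_
      rw [Finset.sum_div]
      refine HasDerivAt.fun_sum fun p hp => ?_
      have := hasDerivAt_triArea hΦ hstar (Finset.mem_filter.1 hp).2.2 hr
      rwa [hswap] at this
    have hlen : ∀ {j k}, T.IsFace i j k → 0 < len r i j - 1 := fun {j k} h =>
      sub_pos.2 (one_lt_coshLen (hstar.starCos hΦ h).hc (hr i) (hr j))
    have hslope : ∀ {j k}, T.IsFace i j k → 0 ≤ slope r i j k := fun {j k} h =>
      (hstar.starCos hΦ h).angleSlope_nonneg (hr i) (hr j) (hr k)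
    rw [hA]
    constructor
    · refine Finset.sum_pos (fun p hp => ?_) ?_
      · have h := (Finset.mem_filter.1 hp).2.2
        have e1 := mul_nonneg (hlen h).le (hslope h)
        have e2 := mul_nonneg (hlen h.swap).le (hslope h.swap)
        refine (add_nonneg e1 e2).lt_of_ne' fun h0 => ?_
        have f1 := (mul_eq_zero.1 (by linarith : (len r i p.1 - 1) * slope r i p.1 p.2 = 0)
          ).resolve_left (hlen h).ne'
        have f2 := (mul_eq_zero.1 (by linarith : (len r i p.2 - 1) * slope r i p.2 p.1 = 0)
          ).resolve_left (hlen h.swap).ne'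
        have H := hstar.starCos hΦ h
        have g1 := (H.angleSlope_eq_zero_iff (hr _) (hr _) (hr _)).1 f1
        have g2 := ((hstar.starCos hΦ h.swap).angleSlope_eq_zero_iff (hr _) (hr _) (hr _)).1 f2
        linarith [H.ha, g1.2, g2.1]
      · obtain ⟨p, hp⟩ := T.exists_isFace_lt i
        exact ⟨p, Finset.mem_filter.2 ⟨Finset.mem_univ _, hp⟩⟩
    · calc _ ≤ ∑ p : Fin N × Fin N with p.1 < p.2 ∧ T.IsFace i p.1 p.2,
            (|C i p.1 p.2| + |C i p.2 p.1|) := by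
            refine Finset.sum_le_sum fun p hp => ?_
            have h := (Finset.mem_filter.1 hp).2.2
            exact add_le_add ((hC _ _ _ h r hr).2.trans (le_abs_self _))
              ((hC _ _ _ h.swap r hr).2.trans (le_abs_self _))
        _ ≤ ∑ p : Fin N × Fin N, (|C i p.1 p.2| + |C i p.2 p.1|) :=
            Finset.sum_le_sum_of_subset_of_nonneg (Finset.filter_subset _ _)
              fun _ _ _ => by positivity
        _ ≤ ∑ i, ∑ p : Fin N × Fin N, (|C i p.1 p.2| + |C i p.2 p.1|) :=
            Finset.single_le_sum (f := fun i => ∑ p : Fin N × Fin N,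
              (|C i p.1 p.2| + |C i p.2 p.1|)) (fun _ _ => by positivity) (Finset.mem_univ i)
        _ ≤ _ := by linarith
  · have hB : coeffB Φ T r i j = ∑ k with T.IsFace i j k, slope r i j k :=
      Finset.sum_congr rfl fun k hk => uDeriv_triAngle hΦ hstar (Finset.mem_filter.1 hk).2 hr
    have hslope : ∀ k ∈ Finset.univ.filter (fun k => T.IsFace i j k), 0 ≤ slope r i j k :=
      fun k hk => (hstar.starCos hΦ (Finset.mem_filter.1 hk).2).angleSlope_nonneg
        (hr i) (hr j) (hr k)
    rw [hB]
    refine ⟨Finset.sum_nonneg hslope, ?_, ?_⟩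
    · calc _ ≤ ∑ k with T.IsFace i j k, |C i j k| := Finset.sum_le_sum fun k hk =>
            (hC _ _ _ (Finset.mem_filter.1 hk).2 r hr).1.trans (le_abs_self _)
        _ ≤ ∑ k, |C i j k| := Finset.sum_le_sum_of_subset_of_nonneg (Finset.filter_subset _ _)
              fun _ _ _ => by positivity
        _ ≤ ∑ j, ∑ k, |C i j k| := Finset.single_le_sum (f := fun j => ∑ k, |C i j k|)
              (fun _ _ => by positivity) (Finset.mem_univ j)
        _ ≤ ∑ i, ∑ j, ∑ k, |C i j k| := Finset.single_le_sum (f := fun i => ∑ j, ∑ k, |C i j k|)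
              (fun _ _ => by positivity) (Finset.mem_univ i)
        _ ≤ _ := by linarith
    · have hzero : ∀ k, T.IsFace i j k →
          (slope r i j k = 0 ↔ Φ s(i, j) = 0 ∧ Φ s(i, k) + Φ s(j, k) = π) := fun k h =>
        ((hstar.starCos hΦ h).angleSlope_eq_zero_iff (hr i) (hr j) (hr k)).trans
          (hΦ.cos_eq_one_and_iff h)
      rw [Finset.sum_eq_zero_iff_of_nonneg hslope]
      simp only [Finset.mem_filter, Finset.mem_univ, true_and]
      obtain ⟨k, hk⟩ := exists_isFace hij
      exact ⟨fun h => ⟨((hzero k hk).1 (h k hk)).1, fun l hl => ((hzero l hl).1 (h l hl)).2⟩,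
        fun h l hl => (hzero l hl).2 ⟨h.1, h.2 l hl⟩⟩
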